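/- **Theorem 4.2.** Permutations $\pi\in\mathfrak S_m$ of $[m]=\{1,\dots,m\}$ are written in one-line notation $\pi=\pi_1\cdots\pi_m$. For $n\ge 0$ let - $\mathcal{CO}_{2n}$ be the set of *collapsed* permutations $\pi\in\mathfrak S_{2n}$, i.e. those with $1+\lfloor k/2\rfloor\le \pi^{-1}(k)\le n+\lfloor k/2\rfloor$ for all $k\in[2n]$; - $\mathfrak G^{\mathrm I}_{2n}$ be the set of $\pi\in\mathfrak S_{2n}$ such that for every ascent $\pi_i<\pi_{i+1}$ the letter $\pi_i$ is odd and $\pi_{i+1}$ is even; - $\mathfrak D_{2n}$ be the set of *D-permutations*, i.e. $\sigma\in\mathfrak S_{2n}$ with $\sigma_{2i}\le 2i$ and $\sigma_{2i-1}\ge 2i-1$ for all $i\in[n]$; - $h_n$ be the $n$-th median Genocchi number ($1,2,8,56,608,\dots$ for $n=0,1,2,3,4,\dots$): $h_n=S_{2n+2,1}$, where $(S_{m,k})_{m\ge1}$ is the Seidel triangle given by $S_{1,1}=1$, $S_{m,k}=0$ for $k\notin[1,\lceil m/2\rceil]$, and, for $m\ge 1$ and $k$ in the respective range, $S_{2m,k}=S_{2m-1,k}+S_{2m,k+1}$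 and $S_{2m+1,k}=S_{2m,k}+S_{2m+1,k-1}$. Then for all $n\ge 0$ $$|\mathcal{CO}_{2n+2}|=h_n=|\mathfrak G^{\mathrm I}_{2n}|.$$ Moreover, for all $n\ge 0$: 1. The rule $\theta(\pi)=\sigma$, where $\sigma_{2i-1}=\pi_{n+i+1}-1$ and $\sigma_{2i}=\pi_{i+1}-1$ for $1\le i\le n$, defines a bijection $\theta:\mathcal{CO}_{2n+2}\to\mathfrak D_{2n}$. 2. The following rule defines a bijection $\vartheta:\mathfrak G^{\mathrm I}_{2n}\to\mathfrak D_{2n}$. Given $\pi\in\mathfrak G^{\mathrm I}_{2n}$, cut its one-line notation before each left-to-right minimum and replace each resulting block $c_1c_2\cdots c_k$ by the cycle $(c_1\,c_k\,c_{k-1}\cdots c_2)$; let $\hat\pi$ be the permutation with these cycles. Then, in each cycle of $\hat\pi$, written with its minimum first, take the even letters $c$ with $\hat\pi^{-1}(c)<c<\hat\pi(c)$ one after the other, from right to left, and shift each of them to the right until it is larger than its successor in the cycle (the successor of the last letter being the first one). The resulting cycles are the cycles of $\vartheta(\pi)$. 3. Consequently $\Theta=\vartheta^{-1}\circ\theta$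 is a bijection from $\mathcal{CO}_{2n+2}$ onto $\mathfrak G^{\mathrm I}_{2n}$. -/

import Mathlib

namespace Genocchi

/-- The entries `S_{n,k}` of the Seidel triangle: `S_{1,1} = 1`, `S_{n,k} = 0` unless
`1 ≤ k ≤ ⌈n/2⌉`, and in that range, for the other rows,
`S_{2n,k} = S_{2n-1,k} + S_{2n,k+1}` and `S_{2n+1,k} = S_{2n,k} + S_{2n+1,k-1}`.
(Rows are numbered from `1`; the row `0` is filled with zeros.) -/
def seidel : ℕ → ℕ → ℕ
  | 0, _ => 0
  | 1, k => if k = 1 then 1 else 0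
  | n + 2, k =>
    if 1 ≤ k ∧ k ≤ (n + 3) / 2 then
      if n % 2 = 0 then seidel (n + 1) k + seidel (n + 2) (k + 1)
      else seidel (n + 1) k + seidel (n + 2) (k - 1)
    else 0
  termination_by n k => (n, if n % 2 = 0 then n + 2 - k else k)
  decreasing_by
    all_goals first
      | (apply Prod.Lex.left; omega)
      | (apply Prod.Lex.right
         repeat' split
         all_goals omega)

/-- The median Genocchi numbers `h_0, h_1, h_2, … = 1, 2, 8, 56, …`: the leftmost entries
`S_{2n+2,1}` of the even rows of the Seidel triangle. -/
def medianGenocchi (n : ℕ) : ℕ := seidel (2 * n + 2) 1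

/-- One-line notation with letters and positions numbered from `1`: `entry π i` is the letter
`π_i` of the permutation `π` of `[m]`, for `1 ≤ i ≤ m` (and `0` for other `i`).
The element `a : Fin m` stands for the letter `a + 1`. -/
def entry {m : ℕ} (π : Equiv.Perm (Fin m)) (i : ℕ) : ℕ :=
  if h : 1 ≤ i ∧ i ≤ m then (π ⟨i - 1, by omega⟩ : ℕ) + 1 else 0

/-- The set `CO_{2n}` of collapsed permutations of `[2n]`. -/
def collapsed (n : ℕ) : Set (Equiv.Perm (Fin (2 * n))) :=
  {π | ∀ k, 1 ≤ k → k ≤ 2 * n → 1 + k / 2 ≤ entry π⁻¹ k ∧ entry π⁻¹ k ≤ n + k / 2}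

/-- The set `G^I_{2n}` of permutations of `[2n]` all of whose ascents `π_i < π_{i+1}` have
`π_i` odd and `π_{i+1}` even. -/
def oddEvenAscents (n : ℕ) : Set (Equiv.Perm (Fin (2 * n))) :=
  {π | ∀ i, 1 ≤ i → i + 1 ≤ 2 * n → entry π i < entry π (i + 1) →
    Odd (entry π i) ∧ Even (entry π (i + 1))}

/-- The set of D-permutations of `[2n]`. -/
def dPerms (n : ℕ) : Set (Equiv.Perm (Fin (2 * n))) :=
  {σ | ∀ i, 1 ≤ i → i ≤ n → entry σ (2 * i) ≤ 2 * i ∧ 2 * i - 1 ≤ entry σ (2 * i - 1)}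

/-- Cut a word before each of its left-to-right minima. -/
def lrMinBlocks {m : ℕ} : List (Fin m) → List (List (Fin m))
  | [] => []
  | a :: t => (a :: t.takeWhile (fun b => a < b)) :: lrMinBlocks (t.dropWhile (fun b => a < b))
  termination_by w => w.length
  decreasing_by
    simp only [List.length_cons]
    exact Nat.lt_succ_of_le (List.dropWhile_suffix _).length_le

/-- `c₁ c₂ ⋯ c_k ↦ c₁ c_k ⋯ c₂`. -/
def reverseTail {m : ℕ} : List (Fin m) → List (Fin m)
  | [] => []
  | c :: t => c :: t.reverse

/-- The permutation whose cycle notation consists of the given (disjoint) cycles. -/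
def ofCycles {m : ℕ} (cs : List (List (Fin m))) : Equiv.Perm (Fin m) :=
  (cs.map List.formPerm).prod

/-- The cycles obtained from the one-line notation of `π`: cut before each left-to-right
minimum, then reverse the order inside each cycle. -/
def cycleWords {m : ℕ} (π : Equiv.Perm (Fin m)) : List (List (Fin m)) :=
  (lrMinBlocks (List.ofFn π)).map reverseTail

/-- The letter `c` is an even cyclic double ascent of `ρ`: it is an even letter, larger than
its predecessor and smaller than its successor in its cycle. -/
def IsEvenCyclicDoubleAscent {m : ℕ} (ρ : Equiv.Perm (Fin m)) (c : Fin m) : Prop :=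
  Even ((c : ℕ) + 1) ∧ ρ⁻¹ c < c ∧ c < ρ c

instance {m : ℕ} (ρ : Equiv.Perm (Fin m)) (c : Fin m) :
    Decidable (IsEvenCyclicDoubleAscent ρ c) := by
  unfold IsEvenCyclicDoubleAscent; infer_instance

/-- Shift the letter `x`, standing in front of the given word (the rest of a cycle that is
written with its minimum first), to the right until it is larger than its successor. At the
right end of the word the successor of `x` is the minimum of the cycle. -/
def shiftRight {m : ℕ} (x : Fin m) : List (Fin m) → List (Fin m)
  | [] => [x]
  | y :: t => if y < x then x :: y :: t else y :: shiftRight x t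

/-- In a cycle of `ρ`, written with its minimum first, shift every even cyclic double ascent
of `ρ` to the right until it is larger than its successor (the rightmost ones first). -/
def shiftCycle {m : ℕ} (ρ : Equiv.Perm (Fin m)) (w : List (Fin m)) : List (Fin m) :=
  w.foldr (fun c acc => if IsEvenCyclicDoubleAscent ρ c then shiftRight c acc else c :: acc) []

/-- The map `ϑ`: turn the one-line notation of `π` into the cycle notation of a permutation
`ρ` by cutting before the left-to-right minima and reversing the order inside each cycle,
then shift the even cyclic double ascents inside each cycle of `ρ`. -/
def vartheta {m : ℕ} (π : Equiv.Perm (Fin m)) : Equiv.Perm (Fin m) :=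
  ofCycles ((cycleWords π).map (shiftCycle (ofCycles (cycleWords π))))

/-- The map `θ` from collapsed permutations of `[2n+2]` to D-permutations of `[2n]` is given by
`σ_{2i-1} = π_{n+i+1} - 1` and `σ_{2i} = π_{i+1} - 1` for `1 ≤ i ≤ n`, where `σ = θ(π)`. -/
def IsTheta {n : ℕ} (θ : collapsed (n + 1) → dPerms n) : Prop :=
  ∀ π : collapsed (n + 1), ∀ i, 1 ≤ i → i ≤ n →
    entry (θ π).1 (2 * i - 1) + 1 = entry π.1 (n + i + 1) ∧
    entry (θ π).1 (2 * i) + 1 = entry π.1 (i + 1)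

end Genocchi

/-! Everything is compared with D-permutations. A collapsed permutation fixes its first and last
letters; at every other position one of the two bounds is automatic and the other is the inequality
defining D-permutations, so `θ` only relabels positions.

For `ϑ`, cutting at left-to-right minima and reversing is Foata's fundamental bijection; it turns
the ascent condition into "descents go from even to odd letters" along each closed cycle word.
Behind its minimum, a cycle word is split recursively at its smallest letter as `L x R`. In the
source an even `x` forces `L` to be empty, in the target it forces `R` to be empty, and in both an
odd `x` forces `R` to be nonempty. Moving each even `x` from the front to the back of its word
(`Shifts`) therefore matches the two classes of words, and `shiftCycle` computes exactly this.

For the count, let `D f = Δ((x - 1) f)`, `N = x D`, `K = (x - 1) D`. The relation `D K = N D + K`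
(`downOp_downOp`) is the Seidel recurrence for odd rows, and the entries of the even rows are `(N^a
K^b 1)(1)`; hence `h_n = (N^(n+1) 1)(1)`. On the other side, D-permutations are the case `e = 0` of
placements on a board with `e` free rows. Their recursion (`boardCount_dBoard_succ`) is, up to
normalisation, the application of `N` at `x = e + 1`. -/

namespace Genocchi

/-! ### Difference operators and the Seidel triangle -/

/-- The operator `f ↦ Δ((x - 1) f)` on functions on the integers. -/
def diffOp : Module.End ℤ (ℤ → ℤ) where
  toFun f x := x * f (x + 1) - (x - 1) * f x
  map_add' f g := by funext x; simp only [Pi.add_apply]; ring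
  map_smul' c f := by
    funext x; simp only [Pi.smul_apply, smul_eq_mul, eq_intCast, Int.cast_id]; ring

/-- The operator `f ↦ x Δ((x - 1) f)`. -/
def upOp : Module.End ℤ (ℤ → ℤ) where
  toFun f x := x * diffOp f x
  map_add' f g := by funext x; simp only [map_add, Pi.add_apply]; ring
  map_smul' c f := by
    funext x; simp only [map_smul, Pi.smul_apply, smul_eq_mul, eq_intCast, Int.cast_id]; ring

/-- The operator `f ↦ (x - 1) Δ((x - 1) f)`. -/
def downOp : Module.End ℤ (ℤ → ℤ) where
  toFun f x := (x - 1) * diffOp f x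
  map_add' f g := by funext x; simp only [map_add, Pi.add_apply]; ring
  map_smul' c f := by
    funext x; simp only [map_smul, Pi.smul_apply, smul_eq_mul, eq_intCast, Int.cast_id]; ring

lemma upOp_apply (f : ℤ → ℤ) (x : ℤ) :
    upOp f x = x * (x * f (x + 1) - (x - 1) * f x) := rfl

lemma downOp_apply (f : ℤ → ℤ) (x : ℤ) :
    downOp f x = (x - 1) * (x * f (x + 1) - (x - 1) * f x) := rfl

/-- With `N - K = D`, this is `D K = N D + K`, written without `D`. -/
lemma downOp_downOp (g : ℤ → ℤ) :
    downOp (downOp g) = upOp (downOp g) + upOp (downOp g) - downOp g - upOp (upOp g) := by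
  funext x
  simp only [Pi.add_apply, Pi.sub_apply, upOp_apply, downOp_apply]
  ring

/-- The values at `1` of the functions `N^a K^b 1`, where `N = upOp` and `K = downOp`. -/
def opValue (a b : ℕ) : ℤ := (upOp ^ a) ((downOp ^ b) 1) 1

lemma opValue_add_two (a b : ℕ) :
    opValue a (b + 2) =
      2 * opValue (a + 1) (b + 1) - opValue a (b + 1) - opValue (a + 2) b := by
  have h : (downOp ^ (b + 2)) (1 : ℤ → ℤ) = downOp (downOp ((downOp ^ b) 1)) := by
    rw [pow_succ', pow_succ']; rfl
  have h1 : (downOp ^ (b + 1)) (1 : ℤ → ℤ) = downOp ((downOp ^ b) 1) := by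
    rw [pow_succ']; rfl
  have h2 (f : ℤ → ℤ) : (upOp ^ (a + 1)) f = (upOp ^ a) (upOp f) := by
    rw [pow_succ]; rfl
  have h3 (f : ℤ → ℤ) : (upOp ^ (a + 2)) f = (upOp ^ a) (upOp (upOp f)) := by
    rw [pow_succ, pow_succ]; rfl
  simp only [opValue, h, h1, h2, h3, downOp_downOp, map_add, map_sub, Pi.add_apply, Pi.sub_apply]
  ring

lemma opValue_one (a : ℕ) : opValue a 1 = opValue (a + 1) 0 - opValue a 0 := by
  have h : downOp (1 : ℤ → ℤ) = upOp 1 - 1 := by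
    funext x
    simp only [Pi.sub_apply, upOp_apply, downOp_apply, Pi.one_apply]
    ring
  have h2 (f : ℤ → ℤ) : (upOp ^ (a + 1)) f = (upOp ^ a) (upOp f) := by
    rw [pow_succ]; rfl
  simp only [opValue, pow_one, pow_zero, Module.End.one_apply, h, h2, map_sub, Pi.sub_apply]

/-- The factor `x - 1` of `downOp` vanishes at `1`. -/
lemma opValue_zero_succ (b : ℕ) : opValue 0 (b + 1) = 0 := by
  have h1 : (downOp ^ (b + 1)) (1 : ℤ → ℤ) = downOp ((downOp ^ b) 1) := by
    rw [pow_succ']; rfl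
  simp [opValue, h1, downOp_apply]

lemma seidel_even (m k : ℕ) (h1 : 1 ≤ k) (h2 : k ≤ m + 1) :
    seidel (2 * m + 2) k = seidel (2 * m + 1) k + seidel (2 * m + 2) (k + 1) := by
  rw [seidel, if_pos (by omega), if_pos (by omega)]

lemma seidel_odd (m k : ℕ) (h1 : 1 ≤ k) (h2 : k ≤ m + 2) :
    seidel (2 * m + 3) k = seidel (2 * m + 2) k + seidel (2 * m + 3) (k - 1) := by
  rw [show 2 * m + 3 = (2 * m + 1) + 2 from rfl, seidel, if_pos (by omega), if_neg (by omega)]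

lemma seidel_even_of_lt (m k : ℕ) (h : m + 1 < k) : seidel (2 * m + 2) k = 0 := by
  rw [seidel, if_neg (by omega)]

lemma seidel_odd_zero (m : ℕ) : seidel (2 * m + 3) 0 = 0 := by
  rw [show 2 * m + 3 = (2 * m + 1) + 2 from rfl, seidel, if_neg (by omega)]

/-- Odd rows hold `(N^a D K^b 1)(1)` with `D = N - K`. The even-row recurrence is then a
telescoping, and the odd-row recurrence is the commutation rule, started by `D 1 = 1`. -/
lemma seidel_eq_opValue (m : ℕ) :
    (∀ a b, a + b = m → (seidel (2 * m + 1) (b + 1) : ℤ) = opValue (a + 1) b - opValue a (b + 1)) ∧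
    (∀ a b, a + b = m + 1 → (seidel (2 * m + 2) (b + 1) : ℤ) = opValue a b) := by
  have even_row (m : ℕ)
      (h : ∀ a b, a + b = m →
        (seidel (2 * m + 1) (b + 1) : ℤ) = opValue (a + 1) b - opValue a (b + 1)) :
      ∀ a b, a + b = m + 1 → (seidel (2 * m + 2) (b + 1) : ℤ) = opValue a b := by
    intro a
    induction a with
    | zero =>
      intro b hb
      obtain rfl : b = m + 1 := by omega
      rw [seidel_even_of_lt _ _ (by omega), opValue_zero_succ]; rfl
    | succ a ih =>
      intro b hb
      rw [seidel_even _ _ (by omega) (by omega), Nat.cast_add, h a b (by omega),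
        ih (b + 1) (by omega)]
      ring
  induction m with
  | zero =>
    have h0 : ∀ a b, a + b = 0 →
        (seidel (2 * 0 + 1) (b + 1) : ℤ) = opValue (a + 1) b - opValue a (b + 1) := by
      intro a b hab
      obtain ⟨rfl, rfl⟩ : a = 0 ∧ b = 0 := by omega
      rw [opValue_zero_succ, mul_zero, zero_add, seidel]
      simp [opValue, upOp_apply]
    exact ⟨h0, even_row 0 h0⟩
  | succ m ih =>
    have h1 : ∀ b a, a + b = m + 1 →
        (seidel (2 * m + 3) (b + 1) : ℤ) = opValue (a + 1) b - opValue a (b + 1) := by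
      intro b
      induction b with
      | zero =>
        intro a hab
        rw [seidel_odd _ _ (by omega) (by omega), Nat.add_sub_cancel, seidel_odd_zero,
          Nat.add_zero, ih.2 a 0 hab, opValue_one]
        ring
      | succ b ihb =>
        intro a hab
        rw [seidel_odd _ _ (by omega) (by omega), Nat.add_sub_cancel, Nat.cast_add,
          ih.2 a (b + 1) hab, ihb (a + 1) (by omega), opValue_add_two]
        ring
    exact ⟨fun a b => h1 b a, even_row (m + 1) fun a b => h1 b a⟩

lemma medianGenocchi_eq_opValue (n : ℕ) : (medianGenocchi n : ℤ) = opValue (n + 1) 0 :=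
  (seidel_eq_opValue n).2 (n + 1) 0 rfl

/-! ### Counting permutations with restricted positions -/

open Classical in
/-- The number of permutations `σ` of `{0, …, N - 1}` with `R i (σ i)` for all `i`. -/
noncomputable def boardCount (N : ℕ) (R : ℕ → ℕ → Prop) : ℕ :=
  (Finset.univ.filter fun σ : Equiv.Perm (Fin N) => ∀ i : Fin N, R i (σ i)).card

lemma boardCount_congr {N : ℕ} {R R' : ℕ → ℕ → Prop}
    (h : ∀ i < N, ∀ c < N, (R i c ↔ R' i c)) : boardCount N R = boardCount N R' := by
  classical
  unfold boardCount
  congr 1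
  ext σ
  simp only [Finset.mem_filter, Finset.mem_univ, true_and]
  exact forall_congr' fun i => h i i.2 (σ i) (σ i).2

/-- Counts do not depend on the order of the rows; here row `0` moves to the end. -/
lemma boardCount_rotate (N : ℕ) (R : ℕ → ℕ → Prop) :
    boardCount (N + 1) (fun t c => R (if t = N then 0 else t + 1) c) = boardCount (N + 1) R := by
  classical
  refine Finset.card_equiv (Equiv.mulRight (finRotate (N + 1))⁻¹) fun σ => ?_
  simp only [Finset.mem_filter, Finset.mem_univ, true_and, Equiv.coe_mulRight, Equiv.Perm.mul_apply]
  rw [← (finRotate (N + 1)).forall_congr_right (q := fun i : Fin (N + 1) =>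
    R i (σ ((finRotate (N + 1))⁻¹ i)))]
  refine forall_congr' fun i => ?_
  rw [Equiv.Perm.inv_def, Equiv.symm_apply_apply, coe_finRotate]
  simp only [Fin.ext_iff, Fin.val_last]

/-- No other row distinguishes the `b` columns open to row `0`, so whichever is used, the rest
counts as if column `0` had been deleted. -/
lemma boardCount_remove {N b : ℕ} (hb : b ≤ N + 1) {R : ℕ → ℕ → Prop}
    (h0 : ∀ c < N + 1, (R 0 c ↔ c < b))
    (hR : ∀ i < N, ∀ c < b, ∀ c' < b, (R (i + 1) c ↔ R (i + 1) c')) :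
    boardCount (N + 1) R = b * boardCount N fun t c => R (t + 1) (c + 1) := by
  classical
  have hcard : (Finset.univ.filter fun p : Fin (N + 1) => (p : ℕ) < b).card = b := by
    rw [Fin.card_filter_val_lt, min_eq_right hb]
  unfold boardCount
  conv_rhs => rw [← hcard]
  rw [← Finset.card_product]
  refine Finset.card_equiv Equiv.Perm.decomposeFin fun σ => ?_
  obtain ⟨⟨p, τ⟩, rfl⟩ := Equiv.Perm.decomposeFin.symm.surjective σ
  simp only [Finset.mem_filter, Finset.mem_univ, true_and, Equiv.apply_symm_apply,
    Finset.mem_product, Fin.forall_fin_succ, Equiv.Perm.decomposeFin_symm_apply_zero,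
    Equiv.Perm.decomposeFin_symm_apply_succ, Fin.val_zero, Fin.val_succ]
  rw [h0 p p.2]
  refine and_congr_right fun hp => forall_congr' fun i => ?_
  -- The swap of `0` and `p` affects only the row that would take `p`: it takes column `0` instead,
  -- and both columns are below `b`.
  by_cases hi : (τ i).succ = p
  · rw [hi, Equiv.swap_apply_right, ← Fin.val_succ (τ i), hi]
    exact hR i i.2 _ (by simp; omega) _ hp
  · rw [Equiv.swap_apply_of_ne_of_ne (Fin.succ_ne_zero _) hi, Fin.val_succ]

lemma boardCount_free_row (N : ℕ) (R : ℕ → ℕ → Prop) :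
    boardCount (N + 1) (fun t c => t = 0 ∨ R t c) =
      boardCount (N + 1) R + boardCount (N + 1) fun t c => if t = 0 then ¬ R t c else R t c := by
  classical
  unfold boardCount
  rw [← Finset.card_filter_add_card_filter_not (fun σ : Equiv.Perm (Fin (N + 1)) => R 0 (σ 0)),
    Finset.filter_filter, Finset.filter_filter]
  congr 2 <;> ext σ <;>
    simp [Fin.forall_fin_succ, and_comm]

/-- Row `t < 2 n` of the board admits the columns `≥ e + t` if `t` is even and the columns
`≤ e + t` if `t` is odd; all columns are admitted in the other rows. -/
def dBoard (e n t c : ℕ) : Prop := 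
  2 * n ≤ t ∨ t % 2 = 0 ∧ e + t ≤ c ∨ t % 2 = 1 ∧ c ≤ e + t

lemma boardCount_dBoard_zero (e : ℕ) : boardCount e (dBoard e 0) = e.factorial := by
  classical
  unfold boardCount
  rw [Finset.filter_true_of_mem fun σ _ i => Or.inl (by omega), Finset.card_univ,
    Fintype.card_perm, Fintype.card_fin]

/-- Row `0` of the board for `(e, n + 1)` is made free. Then row `1` has `e + 2` columns, and
removing it leaves the board for `(e + 1, n)`. The surplus placements have row `0` in one of the
first `e` columns; row `1` then has `e + 1` choices. -/
lemma boardCount_dBoard_succ (e n : ℕ) :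
    (e + 2) * boardCount (e + 1 + 2 * n) (dBoard (e + 1) n) =
      boardCount (e + 2 * (n + 1)) (dBoard e (n + 1)) +
        e * ((e + 1) * boardCount (e + 2 * n) (dBoard e n)) := by
  have h1 : boardCount (e + 2 * n + 1 + 1) (fun t c => t = 0 ∨ dBoard e (n + 1) t c) =
      (e + 2) * boardCount (e + 1 + 2 * n) (dBoard (e + 1) n) := by
    rw [← boardCount_rotate, boardCount_remove (b := e + 2) (by omega)]
    · rw [show e + 1 + 2 * n = e + 2 * n + 1 by omega]
      congr 1
      refine boardCount_congr fun i hi c hc => ?_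
      grind [dBoard]
    · intro c hc
      grind [dBoard]
    · intro i hi c hc c' hc'
      grind [dBoard]
  have h2 : boardCount (e + 2 * n + 1 + 1)
      (fun t c => if t = 0 then ¬ dBoard e (n + 1) t c else dBoard e (n + 1) t c) =
      e * ((e + 1) * boardCount (e + 2 * n) (dBoard e n)) := by
    rw [boardCount_remove (b := e) (by omega) (fun c hc => ?_) (fun i hi c hc c' hc' => ?_),
      boardCount_remove (b := e + 1) (by omega) (fun c hc => ?_) (fun i hi c hc c' hc' => ?_)]
    · congr 2
      refine boardCount_congr fun i hi c hc => ?_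
      grind [dBoard]
    all_goals
      grind [dBoard]
  rw [← h1, boardCount_free_row, h2]
  rfl

/-- The factors `e + 1` and `e!` normalise the recursion to `upOp` at `e + 1`. -/
lemma boardCount_dBoard (n : ℕ) : ∀ e : ℕ,
    ((e : ℤ) + 1) * boardCount (e + 2 * n) (dBoard e n) =
      e.factorial * (upOp ^ (n + 1)) 1 ((e : ℤ) + 1) := by
  induction n with
  | zero =>
    intro e
    rw [mul_zero, add_zero, boardCount_dBoard_zero, zero_add, pow_one, upOp_apply]
    simp only [Pi.one_apply]
    ring
  | succ n ih =>
    intro e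
    have h := congrArg (Nat.cast : ℕ → ℤ) (boardCount_dBoard_succ e n)
    push_cast at h
    have h1 := ih (e + 1)
    rw [Nat.factorial_succ] at h1
    push_cast at h1
    have h2 : (upOp ^ (n + 1 + 1)) (1 : ℤ → ℤ) = upOp ((upOp ^ (n + 1)) 1) := by
      rw [pow_succ']; rfl
    rw [h2, upOp_apply]
    linear_combination -((e : ℤ) + 1) * h + ((e : ℤ) + 1) * h1 - ((e : ℤ) + 1) * e * ih e

/-! ### D-permutations and their number -/

/-- The letter `x + 1` that stands for `x` is even. -/
def EvenLetter {m : ℕ} (x : Fin m) : Prop := Even ((x : ℕ) + 1)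

lemma evenLetter_iff {m : ℕ} (x : Fin m) : EvenLetter x ↔ (x : ℕ) % 2 = 1 := by
  rw [EvenLetter, Nat.even_iff]; omega

lemma entry_of_mem {m : ℕ} (π : Equiv.Perm (Fin m)) {i : ℕ} (h : i < m) :
    entry π (i + 1) = (π ⟨i, h⟩ : ℕ) + 1 := by
  rw [entry, dif_pos (by omega)]; rfl

lemma mem_dPerms_iff {n : ℕ} (σ : Equiv.Perm (Fin (2 * n))) :
    σ ∈ dPerms n ↔ ∀ x, (¬ EvenLetter x → x ≤ σ x) ∧ (EvenLetter x → σ x ≤ x) := by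
  simp only [dPerms, Set.mem_ofPred_eq, evenLetter_iff, Fin.le_def]
  constructor
  · intro h x
    have hx := x.2
    have := h (x / 2 + 1) (by omega) (by omega)
    rcases Nat.mod_two_eq_zero_or_one x with h2 | h2
    · refine ⟨fun _ => ?_, fun h3 => by omega⟩
      have := this.2
      rw [show 2 * ((x : ℕ) / 2 + 1) - 1 = x + 1 by omega, entry_of_mem σ hx] at this
      simpa using this
    · refine ⟨fun h3 => by omega, fun _ => ?_⟩
      have := this.1
      rw [show 2 * ((x : ℕ) / 2 + 1) = x + 1 by omega, entry_of_mem σ hx] at this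
      simpa using this
  · intro h i h1 h2
    obtain ⟨j, rfl⟩ : ∃ j, i = j + 1 := ⟨i - 1, by omega⟩
    rw [show 2 * (j + 1) = 2 * j + 1 + 1 by omega, entry_of_mem σ (by omega : 2 * j + 1 < 2 * n),
      Nat.add_sub_cancel, entry_of_mem σ (by omega : 2 * j < 2 * n)]
    have ha := (h ⟨2 * j + 1, by omega⟩).2 (by simp only; omega)
    have hb := (h ⟨2 * j, by omega⟩).1 (by simp only; omega)
    simp only at ha hb
    omega

lemma ncard_dPerms (n : ℕ) : (dPerms n).ncard = medianGenocchi n := by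
  classical
  have h1 : (dPerms n).ncard = boardCount (2 * n) (dBoard 0 n) := by
    rw [Set.ncard_eq_toFinset_card', boardCount]
    -- Reversal exchanges both the parities and the inequalities, so conjugation by it preserves the
    -- condition.
    refine Finset.card_equiv ((Fin.revPerm : Equiv.Perm (Fin (2 * n))).permCongr) fun σ => ?_
    simp only [Set.mem_toFinset, mem_dPerms_iff, Finset.mem_filter, Finset.mem_univ, true_and,
      Equiv.permCongr_apply]
    rw [← (Fin.revPerm : Equiv.Perm (Fin (2 * n))).forall_congr_right]
    refine forall_congr' fun x => ?_
    have := x.2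
    simp only [evenLetter_iff, Fin.revPerm_symm, Fin.revPerm_apply, Fin.val_rev, dBoard, Fin.le_def]
    have := (σ x.rev).2
    omega
  have h2 := boardCount_dBoard n 0
  have h3 := medianGenocchi_eq_opValue n
  rw [opValue, pow_zero, Module.End.one_apply] at h3
  simp only [Nat.cast_zero, zero_add, one_mul, Nat.factorial_zero, Nat.cast_one] at h2
  rw [h1]
  exact_mod_cast h2.trans h3.symm

/-! ### The bijection `θ` -/

lemma mem_collapsed_iff {n : ℕ} (π : Equiv.Perm (Fin (2 * n))) :
    π ∈ collapsed n ↔ ∀ p, ((π p : ℕ) + 1) / 2 ≤ p ∧ (p : ℕ) + 1 ≤ n + ((π p : ℕ) + 1) / 2 := by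
  simp only [collapsed, Set.mem_ofPred_eq]
  constructor
  · intro h p
    have := h (π p + 1) (by omega) (π p).2
    rw [entry_of_mem _ (π p).2] at this
    simp only [Fin.eta, Equiv.Perm.inv_def, Equiv.symm_apply_apply] at this
    omega
  · intro h k h1 h2
    obtain ⟨j, rfl⟩ : ∃ j, k = j + 1 := ⟨k - 1, by omega⟩
    have := h (π⁻¹ ⟨j, h2⟩)
    rw [entry_of_mem _ h2]
    simp only [Equiv.Perm.inv_def, Equiv.apply_symm_apply] at this
    rw [Equiv.Perm.inv_def]
    omega

/-- The position in `π` of the letter that gives the letter `σ (x + 1)` of `σ = θ π`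
(both positions numbered from `0` here). -/
def thetaPos {n : ℕ} (x : Fin (2 * n)) : Fin (2 * (n + 1)) :=
  ⟨if (x : ℕ) % 2 = 0 then n + x / 2 + 1 else (x + 1) / 2, by split_ifs <;> omega⟩

lemma thetaPos_injective {n : ℕ} : Function.Injective (thetaPos (n := n)) := by
  intro x y h
  simp only [thetaPos, Fin.ext_iff] at h ⊢
  split_ifs at h <;> omega

lemma exists_thetaPos {n : ℕ} (p : Fin (2 * (n + 1))) :
    (p : ℕ) = 0 ∨ (p : ℕ) = 2 * n + 1 ∨ ∃ x, p = thetaPos x := by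
  by_cases h0 : (p : ℕ) = 0
  · exact Or.inl h0
  by_cases h1 : (p : ℕ) = 2 * n + 1
  · exact Or.inr (Or.inl h1)
  have := p.2
  refine Or.inr (Or.inr ?_)
  by_cases h2 : (p : ℕ) ≤ n
  · refine ⟨⟨2 * p - 1, by omega⟩, ?_⟩
    rw [Fin.ext_iff]
    simp only [thetaPos]
    rw [if_neg (by omega)]
    omega
  · refine ⟨⟨2 * (p - n - 1), by omega⟩, ?_⟩
    rw [Fin.ext_iff]
    simp only [thetaPos]
    rw [if_pos (by omega)]
    omega

/-- `σ` is obtained from `π` by the rule that defines `θ`. -/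
def ThetaRel {n : ℕ} (π : Equiv.Perm (Fin (2 * (n + 1)))) (σ : Equiv.Perm (Fin (2 * n))) : Prop :=
  ∀ x, (π (thetaPos x) : ℕ) = σ x + 1

lemma collapsed_apply_zero {n : ℕ} {π : Equiv.Perm (Fin (2 * (n + 1)))} (hπ : π ∈ collapsed (n + 1))
    (p : Fin (2 * (n + 1))) : ((π p : ℕ) = 0 ↔ (p : ℕ) = 0) := by
  rw [mem_collapsed_iff] at hπ
  have key : ∀ p : Fin (2 * (n + 1)), (p : ℕ) = 0 → (π p : ℕ) = 0 := fun p hp => by have := hπ p; omega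
  refine ⟨fun h => ?_, key p⟩
  have h0 := key ⟨0, by omega⟩ rfl
  have := π.injective (Fin.ext (h.trans h0.symm))
  rw [this]

lemma collapsed_apply_last {n : ℕ} {π : Equiv.Perm (Fin (2 * (n + 1)))} (hπ : π ∈ collapsed (n + 1))
    (p : Fin (2 * (n + 1))) : ((π p : ℕ) = 2 * n + 1 ↔ (p : ℕ) = 2 * n + 1) := by
  rw [mem_collapsed_iff] at hπ
  have key : ∀ p : Fin (2 * (n + 1)), (p : ℕ) = 2 * n + 1 → (π p : ℕ) = 2 * n + 1 := fun p hp => by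
    have := hπ p; have := (π p).2; omega
  refine ⟨fun h => ?_, key p⟩
  have h0 := key ⟨2 * n + 1, by omega⟩ rfl
  have := π.injective (Fin.ext (h.trans h0.symm))
  rw [this]

lemma ThetaRel.mem_dPerms {n : ℕ} {π : Equiv.Perm (Fin (2 * (n + 1)))}
    {σ : Equiv.Perm (Fin (2 * n))} (h : ThetaRel π σ) (hπ : π ∈ collapsed (n + 1)) :
    σ ∈ dPerms n := by
  rw [mem_collapsed_iff] at hπ
  rw [mem_dPerms_iff]
  intro x
  have h1 := hπ (thetaPos x)
  rw [h x] at h1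
  simp only [thetaPos] at h1
  simp only [evenLetter_iff, Fin.le_def]
  split_ifs at h1 <;> omega

lemma exists_thetaRel {n : ℕ} {π : Equiv.Perm (Fin (2 * (n + 1)))} (hπ : π ∈ collapsed (n + 1)) :
    ∃ σ, ThetaRel π σ := by
  have h1 (x : Fin (2 * n)) : 1 ≤ (π (thetaPos x) : ℕ) ∧ (π (thetaPos x) : ℕ) < 2 * n + 1 := by
    have h0 := collapsed_apply_zero hπ (thetaPos x)
    have h1 := collapsed_apply_last hπ (thetaPos x)
    have h2 := (π (thetaPos x)).2
    have h3 : ((thetaPos x : Fin _) : ℕ) ≠ 0 ∧ ((thetaPos x : Fin _) : ℕ) ≠ 2 * n + 1 := by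
      simp only [thetaPos]; split_ifs <;> omega
    omega
  let f : Fin (2 * n) → Fin (2 * n) := fun x =>
    ⟨π (thetaPos x) - 1, by have := h1 x; omega⟩
  have hf : Function.Injective f := by
    intro x y h
    simp only [f, Fin.ext_iff] at h
    have hx := h1 x
    have hy := h1 y
    exact thetaPos_injective (π.injective (Fin.ext (by omega)))
  refine ⟨Equiv.ofBijective f (Finite.injective_iff_bijective.1 hf), fun x => ?_⟩
  have := h1 x
  simp only [Equiv.ofBijective_apply, f]
  omega

lemma exists_collapsed_thetaRel {n : ℕ} {σ : Equiv.Perm (Fin (2 * n))} (hσ : σ ∈ dPerms n) :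
    ∃ π ∈ collapsed (n + 1), ThetaRel π σ := by
  -- The inverse of the desired permutation, from letters to positions, fixing the two extreme
  -- letters.
  let g : Fin (2 * (n + 1)) → Fin (2 * (n + 1)) := fun v =>
    if h : 1 ≤ (v : ℕ) ∧ (v : ℕ) < 2 * n + 1 then thetaPos (σ⁻¹ ⟨v - 1, by omega⟩) else v
  have hg0 (v : Fin (2 * (n + 1))) (h : ¬ (1 ≤ (v : ℕ) ∧ (v : ℕ) < 2 * n + 1)) : g v = v :=
    dif_neg h
  have hg1 (x : Fin (2 * n)) : g ⟨σ x + 1, by omega⟩ = thetaPos x := by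
    simp only [g]
    rw [dif_pos (by constructor <;> omega)]
    simp
  have hsurj : Function.Surjective g := by
    intro p
    rcases exists_thetaPos p with h | h | ⟨x, rfl⟩
    · exact ⟨p, hg0 p (by omega)⟩
    · exact ⟨p, hg0 p (by omega)⟩
    · exact ⟨_, hg1 x⟩
  let e := Equiv.ofBijective g (Finite.surjective_iff_bijective.1 hsurj)
  have h1 : ThetaRel e.symm σ := fun x => by
    have : e.symm (thetaPos x) = ⟨σ x + 1, by omega⟩ := by
      rw [Equiv.symm_apply_eq]; exact (hg1 x).symm
    rw [this]
  refine ⟨e.symm, ?_, h1⟩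
  have h0 (p : Fin (2 * (n + 1))) (h : ¬ (1 ≤ (p : ℕ) ∧ (p : ℕ) < 2 * n + 1)) : e.symm p = p := by
    rw [Equiv.symm_apply_eq]; exact (hg0 p h).symm
  rw [mem_collapsed_iff]
  intro p
  rcases exists_thetaPos p with h | h | ⟨x, rfl⟩
  · rw [h0 p (by omega)]; omega
  · rw [h0 p (by omega)]; omega
  · rw [h1 x]
    have := (mem_dPerms_iff σ).1 hσ x
    simp only [evenLetter_iff, Fin.le_def] at this
    simp only [thetaPos]
    split_ifs <;> omega

lemma ThetaRel.collapsed_unique {n : ℕ} {π π' : Equiv.Perm (Fin (2 * (n + 1)))}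
    {σ : Equiv.Perm (Fin (2 * n))} (h : ThetaRel π σ) (h' : ThetaRel π' σ)
    (hπ : π ∈ collapsed (n + 1)) (hπ' : π' ∈ collapsed (n + 1)) : π = π' := by
  ext p
  rcases exists_thetaPos p with h0 | h0 | ⟨x, rfl⟩
  · rw [(collapsed_apply_zero hπ p).2 h0, (collapsed_apply_zero hπ' p).2 h0]
  · rw [(collapsed_apply_last hπ p).2 h0, (collapsed_apply_last hπ' p).2 h0]
  · rw [h x, h' x]

lemma exists_theta (n : ℕ) : ∃ θ : collapsed (n + 1) ≃ dPerms n, IsTheta θ := by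
  choose f hf using fun π : collapsed (n + 1) => exists_thetaRel π.2
  have hbij : Function.Bijective
      fun π : collapsed (n + 1) => (⟨f π, (hf π).mem_dPerms π.2⟩ : dPerms n) := by
    constructor
    · intro π π' h
      have h1 := hf π
      rw [show f π = f π' from congrArg Subtype.val h] at h1
      exact Subtype.ext (h1.collapsed_unique (hf π') π.2 π'.2)
    · rintro ⟨σ, hσ⟩
      obtain ⟨π, hπ, h⟩ := exists_collapsed_thetaRel hσ
      refine ⟨⟨π, hπ⟩, Subtype.ext (Equiv.ext fun x => Fin.ext ?_)⟩
      have h1 := hf ⟨π, hπ⟩ x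
      have h2 := h x
      simp only at h1 ⊢
      omega
  refine ⟨Equiv.ofBijective _ hbij, fun π i h1 h2 => ?_⟩
  obtain ⟨j, rfl⟩ : ∃ j, i = j + 1 := ⟨i - 1, by omega⟩
  have ha := hf π ⟨2 * j, by omega⟩
  have hb := hf π ⟨2 * j + 1, by omega⟩
  simp only [thetaPos] at ha hb
  rw [Equiv.ofBijective_apply, show 2 * (j + 1) = 2 * j + 1 + 1 by omega, Nat.add_sub_cancel,
    entry_of_mem _ (by omega : 2 * j < 2 * n), entry_of_mem _ (by omega : 2 * j + 1 < 2 * n),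
    show n + (j + 1) + 1 = n + j + 1 + 1 by omega,
    entry_of_mem _ (by omega : n + j + 1 < 2 * (n + 1)),
    entry_of_mem _ (by omega : j + 1 < 2 * (n + 1)), ← ha, ← hb]
  constructor <;> congr 4
  · rw [if_pos (by omega)]; omega
  · rw [if_neg (by omega)]; omega

/-! ### Shifting even double ascents by recursive splitting at the minimum -/

variable {m : ℕ}

/-- Every nonempty word splits at its minimum. -/
lemma exists_split_min (w : List (Fin m)) (hw : w ≠ []) (hn : w.Nodup) :
    ∃ L x R, w = L ++ x :: R ∧ (∀ y ∈ L, x < y) ∧ (∀ y ∈ R, x < y) := by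
  have hne : w.toFinset.Nonempty := List.toFinset_nonempty_iff w |>.2 hw
  obtain ⟨x, hx, hmin⟩ := w.toFinset.exists_min_image id hne
  rw [List.mem_toFinset] at hx
  obtain ⟨L, R, rfl⟩ := List.append_of_mem hx
  rw [List.nodup_append, List.nodup_cons] at hn
  refine ⟨L, x, R, rfl, fun y hy => ?_, fun y hy => ?_⟩
  · exact lt_of_le_of_ne (hmin y (by simp [hy])) fun h => hn.2.2 y hy x (by simp) h.symm
  · exact lt_of_le_of_ne (hmin y (by simp [hy])) fun h => hn.2.1.1 (h ▸ hy)

lemma split_min_unique {L L' R R' : List (Fin m)} {x x' : Fin m}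
    (h : L ++ x :: R = L' ++ x' :: R') (hL : ∀ y ∈ L, x < y) (hR : ∀ y ∈ R, x < y)
    (hL' : ∀ y ∈ L', x' < y) (hR' : ∀ y ∈ R', x' < y) : L = L' ∧ x = x' ∧ R = R' := by
  have hx : x = x' := by
    have h1 : x ∈ L' ++ x' :: R' := h ▸ by simp
    have h2 : x' ∈ L ++ x :: R := h ▸ by simp
    simp only [List.mem_append, List.mem_cons] at h1 h2
    rcases h1 with h1 | h1 | h1
    · rcases h2 with h2 | h2 | h2
      · exact absurd (hL' _ h1) (hL _ h2).asymm
      · exact h2.symm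
      · exact absurd (hL' _ h1) (hR _ h2).asymm
    · exact h1
    · rcases h2 with h2 | h2 | h2
      · exact absurd (hR' _ h1) (hL _ h2).asymm
      · exact h2.symm
      · exact absurd (hR' _ h1) (hR _ h2).asymm
  subst hx
  have hn : ∀ l : List (Fin m), (∀ y ∈ l, x < y) → x ∉ l := fun l hl hx => lt_irrefl _ (hl x hx)
  obtain ⟨h1, -, h2⟩ := (List.append_cons_inj_of_notMem (hn _ hL) (hn _ hR)).1 h
  exact ⟨h1, rfl, h2⟩

/-- The descents are from an even to an odd letter. -/
def EvenOddDescent (a b : Fin m) : Prop := b < a → EvenLetter a ∧ ¬ EvenLetter b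

/-- Odd letters are not followed by smaller letters, and even ones not by larger letters. -/
def ParityStep (a b : Fin m) : Prop := (¬ EvenLetter a → a ≤ b) ∧ (EvenLetter a → b ≤ a)

/-- The recursive description, by splitting at the minimum, of the shift of the even double
ascents in the word that follows the minimum of a cycle. -/
inductive Shifts : List (Fin m) → List (Fin m) → Prop
  | nil : Shifts [] []
  | single (x : Fin m) : EvenLetter x → Shifts [x] [x]
  | even (x : Fin m) (R R' : List (Fin m)) : EvenLetter x → R ≠ [] → (∀ y ∈ R, x < y) →
      Shifts R R' → Shifts (x :: R) (R' ++ [x])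
  | odd (x : Fin m) (L L' R R' : List (Fin m)) : ¬ EvenLetter x → R ≠ [] → (∀ y ∈ L, x < y) →
      (∀ y ∈ R, x < y) → Shifts L L' → Shifts R R' → Shifts (L ++ x :: R) (L' ++ x :: R')

lemma Shifts.perm {u v : List (Fin m)} (h : Shifts u v) : u.Perm v := by
  induction h with
  | nil => rfl
  | single => rfl
  | even x R R' _ _ _ _ ih =>
    exact (ih.cons x).trans (List.perm_append_singleton x R').symm
  | odd x L L' R R' _ _ _ _ _ _ ihL ihR => exact ihL.append (ihR.cons x)

lemma Shifts.eq_nil_iff {u v : List (Fin m)} (h : Shifts u v) : u = [] ↔ v = [] := by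
  rw [← List.length_eq_zero_iff, h.perm.length_eq, List.length_eq_zero_iff]

lemma Shifts.forall_lt {u v : List (Fin m)} (h : Shifts u v) {x : Fin m} (hx : ∀ y ∈ u, x < y) :
    ∀ y ∈ v, x < y := fun y hy => hx y (h.perm.mem_iff.2 hy)

/-- A word is determined by its shifted version. -/
lemma Shifts.left_unique {u v : List (Fin m)} (h : Shifts u v) :
    ∀ {u' : List (Fin m)}, Shifts u' v → u = u' := by
  induction h with
  | nil => intro u' h'; exact (h'.eq_nil_iff.2 rfl).symm
  | single x hx =>
    intro u' h'
    exact (List.perm_singleton.1 h'.perm).symm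
  | even x R R' hx hR hlt hRR' ih =>
    intro u' h'
    have hlt' := hRR'.forall_lt hlt
    -- The parity of the minimum of `v` tells which rule produced it, and the split there recovers
    -- the parts.
    generalize hv : R' ++ [x] = v at h'
    cases h' with
    | nil => simp at hv
    | single y hy =>
      exact absurd (by simpa using congrArg List.length hv) (mt hRR'.eq_nil_iff.2 hR)
    | even y S S' hy hS hltS hSS' =>
      obtain ⟨h1, h2⟩ := List.append_inj' hv rfl
      subst h1
      rw [ih hSS', List.singleton_inj.1 h2]
    | odd y L L' S S' hy hS hltL hltS hLL' hSS' =>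
      obtain ⟨-, h2, -⟩ := split_min_unique hv hlt' (by simp) (hLL'.forall_lt hltL)
        (hSS'.forall_lt hltS)
      exact absurd (h2 ▸ hx) hy
  | odd x L L' R R' hx hR hltL hltR hLL' hRR' ihL ihR =>
    intro u' h'
    have hltL' := hLL'.forall_lt hltL
    have hltR' := hRR'.forall_lt hltR
    generalize hv : L' ++ x :: R' = v at h'
    cases h' with
    | nil => simp at hv
    | single y hy =>
      obtain ⟨-, h2, -⟩ := split_min_unique (L' := []) (R' := []) hv hltL' hltR' (by simp)
        (by simp)
      exact absurd hy (h2 ▸ hx)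
    | even y S S' hy hS hltS hSS' =>
      obtain ⟨-, h2, -⟩ := split_min_unique hv hltL' hltR' (hSS'.forall_lt hltS) (by simp)
      exact absurd hy (h2 ▸ hx)
    | odd y K K' S S' hy hS hltK hltS hKK' hSS' =>
      obtain ⟨rfl, rfl, rfl⟩ := split_min_unique hv hltL' hltR' (hKK'.forall_lt hltK)
        (hSS'.forall_lt hltS)
      rw [ihL hKK', ihR hSS']

lemma isChain_split_min {r : Fin m → Fin m → Prop} {a b x : Fin m} {L R : List (Fin m)} :
    (a :: ((L ++ x :: R) ++ [b])).IsChain r ↔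
      (a :: (L ++ [x])).IsChain r ∧ (x :: (R ++ [b])).IsChain r := by
  rw [List.append_assoc, List.cons_append, ← List.cons_append, List.isChain_split,
    List.cons_append]

/-- The letters `a` and `b` are the neighbours of `u` in the cycle; a split at `x` makes `x` a
neighbour of both halves, which keeps the induction going. -/
lemma exists_shifts_of_isChain {a b : Fin m} (u : List (Fin m)) (hu : u.Nodup)
    (ha : ∀ y ∈ u, a < y) (hb : ∀ y ∈ u, b < y)
    (hc : (a :: (u ++ [b])).IsChain EvenOddDescent) : ∃ v, Shifts u v := by
  induction hlen : u.length using Nat.strong_induction_on generalizing u a b with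
  | _ k ih =>
    by_cases hne : u = []
    · exact ⟨[], hne ▸ Shifts.nil⟩
    obtain ⟨L, x, R, rfl, hL, hR⟩ := exists_split_min u hne hu
    rw [isChain_split_min] at hc
    rw [List.nodup_append, List.nodup_cons] at hu
    simp only [List.length_append, List.length_cons] at hlen
    simp only [List.mem_append, List.mem_cons] at ha hb
    -- If `x` is last, then the step from `x` to `b` is a descent.
    have hR0 : R = [] → EvenLetter x := by
      rintro rfl
      exact ((List.isChain_cons_cons.1 hc.2).1 (hb x (by simp))).1
    obtain ⟨R', hR'⟩ := ih R.length (by omega) (a := x) (b := b) R hu.2.1.2 hR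
      (fun y hy => hb y (by simp [hy])) hc.2 rfl
    obtain ⟨L', hL'⟩ := ih L.length (by omega) (a := a) (b := x) L hu.1
      (fun y hy => ha y (by simp [hy])) hL hc.1 rfl
    by_cases hx : EvenLetter x
    -- Otherwise the last letter of `L` would descend to the even letter `x`.
    · have hL0 : L = [] := by
        by_contra hL0
        obtain ⟨K, y, rfl⟩ := List.eq_nil_or_concat' L |>.resolve_left hL0
        have h1 := hc.1
        rw [isChain_split_min] at h1
        exact ((List.isChain_cons_cons.1 h1.2).1 (hL y (by simp))).2 hx
      subst hL0
      by_cases h0 : R = []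
      · exact ⟨_, h0 ▸ Shifts.single x hx⟩
      · exact ⟨_, Shifts.even x R R' hx h0 hR hR'⟩
    · exact ⟨_, Shifts.odd x L L' R R' hx (fun h => hx (hR0 h)) hL hR hL' hR'⟩

lemma exists_shifts_of_isChain' {a b : Fin m} (v : List (Fin m)) (hv : v.Nodup)
    (ha : ∀ y ∈ v, a < y) (hb : ∀ y ∈ v, b < y)
    (hc : (a :: (v ++ [b])).IsChain ParityStep) : ∃ u, Shifts u v := by
  induction hlen : v.length using Nat.strong_induction_on generalizing v a b with
  | _ k ih =>
    by_cases hne : v = []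
    · exact ⟨[], hne ▸ Shifts.nil⟩
    obtain ⟨L, x, R, rfl, hL, hR⟩ := exists_split_min v hne hv
    rw [isChain_split_min] at hc
    rw [List.nodup_append, List.nodup_cons] at hv
    simp only [List.length_append, List.length_cons] at hlen
    simp only [List.mem_append, List.mem_cons] at ha hb
    obtain ⟨R', hR'⟩ := ih R.length (by omega) (a := x) (b := b) R hv.2.1.2 hR
      (fun y hy => hb y (by simp [hy])) hc.2 rfl
    obtain ⟨L', hL'⟩ := ih L.length (by omega) (a := a) (b := x) L hv.1
      (fun y hy => ha y (by simp [hy])) hL hc.1 rfl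
    by_cases hx : EvenLetter x
    -- An even letter cannot be followed by a larger one, so `x` is last; in the preimage it moves
    -- to the front of `L`.
    · have hR0 : R = [] := by
        rcases R with _ | ⟨y, R⟩
        · rfl
        · exact absurd (hR y (by simp)) ((List.isChain_cons_cons.1 hc.2).1.2 hx).not_gt
      subst hR0
      by_cases h0 : L = []
      · subst h0
        exact ⟨_, Shifts.single x hx⟩
      · exact ⟨_, Shifts.even x L' L hx (mt hL'.eq_nil_iff.1 h0)
          (fun y hy => hL y (hL'.perm.mem_iff.1 hy)) hL'⟩
    · have hR0 : R ≠ [] := by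
        rintro rfl
        exact absurd (hb x (by simp)) ((List.isChain_cons_cons.1 hc.2).1.1 hx).not_gt
      exact ⟨_, Shifts.odd x L' L R' R hx (mt hR'.eq_nil_iff.1 hR0)
        (fun y hy => hL y (hL'.perm.mem_iff.1 hy)) (fun y hy => hR y (hR'.perm.mem_iff.1 hy))
        hL' hR'⟩

/-- The right neighbour `b` must be odd because a descent may end there; in the recursion it is
either the old one or an odd minimum. -/
lemma Shifts.isChain_left {u v : List (Fin m)} (h : Shifts u v) : ∀ {a b : Fin m}, u ≠ [] →
    (∀ y ∈ u, a < y) → ¬ EvenLetter b → (a :: (u ++ [b])).IsChain EvenOddDescent := by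
  have asc {a b : Fin m} (h : a < b) : EvenOddDescent a b := fun h' => absurd h h'.asymm
  induction h with
  | nil => intro a b h; exact absurd rfl h
  | single x hx =>
    intro a b _ ha hbo
    simp only [List.cons_append, List.nil_append, List.isChain_cons_cons, List.isChain_singleton,
      and_true]
    exact ⟨asc (ha x (by simp)), fun _ => ⟨hx, hbo⟩⟩
  | even x R R' hx hR hlt _ ih =>
    intro a b _ ha hbo
    rw [List.cons_append, List.isChain_cons_cons]
    exact ⟨asc (ha x (by simp)), ih hR hlt hbo⟩
  | odd x L L' R R' hx hR hltL hltR _ _ ihL ihR =>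
    intro a b _ ha hbo
    rw [isChain_split_min]
    refine ⟨?_, ihR hR hltR hbo⟩
    by_cases hL : L = []
    · subst hL
      simpa using asc (ha x (by simp))
    · exact ihL hL (fun y hy => ha y (by simp [hy])) hx

/-- The left neighbour `a` must be odd because an ascent starts there. -/
lemma Shifts.isChain_right {u v : List (Fin m)} (h : Shifts u v) : ∀ {a b : Fin m}, u ≠ [] →
    (∀ y ∈ u, a < y) → (∀ y ∈ u, b < y) → ¬ EvenLetter a →
    (a :: (v ++ [b])).IsChain ParityStep := by
  have asc {a b : Fin m} (ha : ¬ EvenLetter a) (h : a < b) : ParityStep a b :=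
    ⟨fun _ => h.le, fun h' => absurd h' ha⟩
  have desc {a b : Fin m} (ha : EvenLetter a) (h : b < a) : ParityStep a b :=
    ⟨fun h' => absurd ha h', fun _ => h.le⟩
  induction h with
  | nil => intro a b h; exact absurd rfl h
  | single x hx =>
    intro a b _ ha hb hao
    simp only [List.cons_append, List.nil_append, List.isChain_cons_cons, List.isChain_singleton,
      and_true]
    exact ⟨asc hao (ha x (by simp)), desc hx (hb x (by simp))⟩
  | even x R R' hx hR hlt _ ih =>
    intro a b _ ha hb hao
    rw [isChain_split_min]
    refine ⟨ih hR (fun y hy => ha y (by simp [hy])) hlt hao, ?_⟩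
    simpa using desc hx (hb x (by simp))
  | odd x L L' R R' hx hR hltL hltR hLL' _ ihL ihR =>
    intro a b _ ha hb hao
    rw [isChain_split_min]
    refine ⟨?_, ihR hR hltR (fun y hy => hb y (by simp [hy])) hx⟩
    by_cases hL : L = []
    · rw [hLL'.eq_nil_iff.1 hL]
      simpa using asc hao (ha x (by simp))
    · exact ihL hL (fun y hy => ha y (by simp [hy])) hltL hao

lemma shiftRight_append {x y : Fin m} (h : y < x) (A B : List (Fin m)) :
    shiftRight x (A ++ y :: B) = shiftRight x A ++ y :: B := by
  induction A with
  | nil => simp [shiftRight, h]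
  | cons z A ih =>
    simp only [List.cons_append, shiftRight]
    split_ifs
    · rfl
    · rw [ih]; rfl

lemma shiftRight_of_forall_lt {x : Fin m} {A : List (Fin m)} (h : ∀ y ∈ A, x < y) :
    shiftRight x A = A ++ [x] := by
  induction A with
  | nil => rfl
  | cons z A ih =>
    rw [shiftRight, if_neg (h z (by simp)).not_gt, ih fun y hy => h y (by simp [hy])]
    rfl

lemma shiftCycle_nil (ρ : Equiv.Perm (Fin m)) : shiftCycle ρ [] = [] := rfl

lemma shiftCycle_cons (ρ : Equiv.Perm (Fin m)) (x : Fin m) (w : List (Fin m)) :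
    shiftCycle ρ (x :: w) =
      if IsEvenCyclicDoubleAscent ρ x then shiftRight x (shiftCycle ρ w) else x :: shiftCycle ρ w :=
  rfl

/-- Larger letters that are shifted from the left stop in front of `x` at the latest. -/
lemma shiftCycle_append {ρ : Equiv.Perm (Fin m)} {x : Fin m} (hx : ¬ IsEvenCyclicDoubleAscent ρ x)
    {L : List (Fin m)} (hL : ∀ y ∈ L, x < y) (R : List (Fin m)) :
    shiftCycle ρ (L ++ x :: R) = shiftCycle ρ L ++ x :: shiftCycle ρ R := by
  induction L with
  | nil => simp [shiftCycle_cons, hx, shiftCycle_nil]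
  | cons y L ih =>
    rw [List.cons_append, shiftCycle_cons, shiftCycle_cons, ih fun z hz => hL z (by simp [hz])]
    split_ifs
    · rw [shiftRight_append (hL y (by simp))]
    · rfl

/-- An even minimum at the front of a word with further letters has a smaller predecessor `a` and a
larger successor, so it is a double ascent and passes the whole word; if it is alone, its successor
is the smaller `b`. -/
lemma Shifts.shiftCycle_eq {ρ : Equiv.Perm (Fin m)} {u v : List (Fin m)} (h : Shifts u v) :
    ∀ {a b : Fin m}, (∀ y ∈ u, a < y) → (∀ y ∈ u, b < y) →
      (a :: (u ++ [b])).IsChain (fun x y => ρ x = y) → shiftCycle ρ u = v := by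
  induction h with
  | nil => intros; rfl
  | single x hx =>
    intro a b ha hb hc
    simp only [List.cons_append, List.nil_append, List.isChain_cons_cons, List.isChain_singleton,
      and_true] at hc
    rw [shiftCycle_cons, if_neg, shiftCycle_nil]
    rintro ⟨-, -, h⟩
    exact absurd (hb x (by simp)) (hc.2 ▸ h).asymm
  | even x R R' hx hR hlt hRR' ih =>
    intro a b ha hb hc
    rw [List.cons_append, List.isChain_cons_cons] at hc
    rw [shiftCycle_cons, ih hlt (fun y hy => hb y (by simp [hy])) hc.2, if_pos,
      shiftRight_of_forall_lt (hRR'.forall_lt hlt)]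
    obtain ⟨y, R, rfl⟩ := List.exists_cons_of_ne_nil hR
    refine ⟨hx, ?_, ?_⟩
    · rw [← hc.1, Equiv.Perm.inv_def, Equiv.symm_apply_apply, hc.1]
      exact ha x (by simp)
    · rw [(List.isChain_cons_cons.1 hc.2).1]
      exact hlt y (by simp)
  | odd x L L' R R' hx hR hltL hltR hLL' hRR' ihL ihR =>
    intro a b ha hb hc
    rw [isChain_split_min] at hc
    rw [shiftCycle_append (fun h => hx h.1) hltL,
      ihL (fun y hy => ha y (by simp [hy])) hltL hc.1,
      ihR hltR (fun y hy => hb y (by simp [hy])) hc.2]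

/-! ### Standard cycle notation -/

/-- The cycle words of a permutation, each starting with its minimum, ordered by decreasing
minima. -/
structure IsStandard (cs : List (List (Fin m))) : Prop where
  head_lt : ∀ w ∈ cs, ∃ c t, w = c :: t ∧ ∀ x ∈ t, c < x
  heads : (cs.map List.head?).Pairwise fun o o' => ∃ c ∈ o, ∃ c' ∈ o', c' < c
  nodup : cs.flatten.Nodup
  mem : ∀ x, x ∈ cs.flatten

lemma IsStandard.of_forall₂ {cs cs' : List (List (Fin m))} (h : IsStandard cs)
    (h' : List.Forall₂ (fun w w' => ∃ c t t', w = c :: t ∧ w' = c :: t' ∧ t.Perm t') cs cs') :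
    IsStandard cs' := by
  have hp : cs.flatten.Perm cs'.flatten := by
    refine List.Perm.flatten_congr (h'.imp ?_)
    rintro _ _ ⟨c, t, t', rfl, rfl, ht⟩
    exact ht.cons c
  have hh : cs.map List.head? = cs'.map List.head? := by
    rw [← List.forall₂_eq_eq_eq, List.forall₂_map_left_iff, List.forall₂_map_right_iff]
    refine h'.imp ?_
    rintro _ _ ⟨c, t, t', rfl, rfl, ht⟩
    rfl
  refine ⟨fun w hw => ?_, hh ▸ h.heads, hp.nodup_iff.1 h.nodup, fun x => hp.mem_iff.1 (h.mem x)⟩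
  obtain ⟨i, hi, rfl⟩ := List.getElem_of_mem hw
  obtain ⟨c, t, t', h1, h2, h3⟩ := h'.get (h'.length_eq ▸ hi) hi
  obtain ⟨c', s, h4, h5⟩ := h.head_lt _ (List.getElem_mem (h'.length_eq ▸ hi))
  rw [List.get_eq_getElem] at h1 h2
  obtain ⟨rfl, rfl⟩ := List.cons_eq_cons.1 (h1.symm.trans h4)
  exact ⟨c, t', h2, fun x hx => h5 x (h3.mem_iff.2 hx)⟩

lemma ofCycles_cons (w : List (Fin m)) (cs : List (List (Fin m))) :
    ofCycles (w :: cs) = w.formPerm * ofCycles cs := by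
  rw [ofCycles, List.map_cons, List.prod_cons]; rfl

lemma ofCycles_apply_of_notMem {cs : List (List (Fin m))} {x : Fin m} (hx : x ∉ cs.flatten) :
    ofCycles cs x = x := by
  induction cs with
  | nil => rfl
  | cons w cs ih =>
    rw [List.flatten_cons, List.mem_append, not_or] at hx
    rw [ofCycles_cons, Equiv.Perm.mul_apply, ih hx.2, List.formPerm_apply_of_notMem hx.1]

lemma ofCycles_apply_of_mem {cs : List (List (Fin m))} (hn : cs.flatten.Nodup) {w : List (Fin m)}
    (hw : w ∈ cs) {x : Fin m} (hx : x ∈ w) : ofCycles cs x = w.formPerm x := by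
  induction cs with
  | nil => simp at hw
  | cons w' cs ih =>
    rw [List.flatten_cons, List.nodup_append'] at hn
    rw [ofCycles_cons, Equiv.Perm.mul_apply]
    rcases List.mem_cons.1 hw with rfl | hw
    · rw [ofCycles_apply_of_notMem (hn.2.2 hx)]
    · rw [ih hn.2.1 hw]
      exact List.formPerm_apply_of_notMem fun h =>
        hn.2.2 h (List.mem_flatten_of_mem hw (List.formPerm_apply_mem_of_mem hx))

lemma isChain_formPerm {c : Fin m} {t : List (Fin m)} (hn : (c :: t).Nodup) :
    (c :: (t ++ [c])).IsChain fun x y => (c :: t).formPerm x = y := by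
  rw [← List.cons_append, List.isChain_append]
  refine ⟨?_, List.isChain_singleton _, ?_⟩
  · rw [List.isChain_iff_getElem]
    exact fun i hi => List.formPerm_apply_lt_getElem _ hn i hi
  · intro x hx y hy
    rw [List.getLast?_eq_getLast_of_ne_nil (List.cons_ne_nil c t), Option.mem_some] at hx
    rw [List.head?_cons, Option.mem_some] at hy
    rw [← hx, ← hy, List.formPerm_apply_getLast]

lemma IsStandard.isChain {cs : List (List (Fin m))} (h : IsStandard cs) {c : Fin m}
    {t : List (Fin m)} (hw : c :: t ∈ cs) :
    (c :: (t ++ [c])).IsChain fun x y => ofCycles cs x = y := by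
  refine (isChain_formPerm ((List.nodup_flatten.1 h.nodup).1 _ hw)).imp_of_mem_imp ?_
  intro x y hx _ hxy
  rw [ofCycles_apply_of_mem h.nodup hw (by simpa [or_comm] using hx), hxy]

lemma IsStandard.lt_of_mem {cs : List (List (Fin m))} (h : IsStandard cs) {c : Fin m}
    {t : List (Fin m)} (hw : c :: t ∈ cs) : ∀ x ∈ t, c < x := by
  obtain ⟨c', t', h1, h2⟩ := h.head_lt _ hw
  obtain ⟨rfl, rfl⟩ := List.cons_eq_cons.1 h1
  exact h2

lemma IsStandard.exists_mem {cs : List (List (Fin m))} (h : IsStandard cs) (x : Fin m) :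
    ∃ c t, c :: t ∈ cs ∧ x ∈ c :: t := by
  obtain ⟨w, hw, hx⟩ := List.mem_flatten.1 (h.mem x)
  obtain ⟨c, t, rfl, -⟩ := h.head_lt w hw
  exact ⟨c, t, hw, hx⟩

lemma IsStandard.eq_of_mem {cs : List (List (Fin m))} (h : IsStandard cs) {w w' : List (Fin m)}
    (hw : w ∈ cs) (hw' : w' ∈ cs) {x : Fin m} (hx : x ∈ w) (hx' : x ∈ w') : w = w' := by
  by_contra hne
  have : Std.Symm (List.Disjoint (α := Fin m)) := ⟨fun _ _ h => h.symm⟩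
  exact (List.nodup_flatten.1 h.nodup).2.forall hw hw' hne hx hx'

lemma mem_of_isChain {ρ : Equiv.Perm (Fin m)} {S : Set (Fin m)} (hS : ∀ x ∈ S, ρ x ∈ S) {a : Fin m}
    {l : List (Fin m)} (ha : a ∈ S) (hc : (a :: l).IsChain fun x y => ρ x = y) :
    ∀ x ∈ a :: l, x ∈ S := by
  induction l generalizing a with
  | nil => simpa using ha
  | cons b l ih =>
    rw [List.isChain_cons_cons] at hc
    rw [List.forall_mem_cons]
    exact ⟨ha, ih (hc.1 ▸ hS a ha) hc.2⟩

lemma rel_apply_of_isChain {ρ : Equiv.Perm (Fin m)} {r : Fin m → Fin m → Prop} {a c : Fin m}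
    {l : List (Fin m)} (hc : (a :: (l ++ [c])).IsChain fun x y => ρ x = y)
    (hr : (a :: (l ++ [c])).IsChain r) : ∀ x ∈ a :: l, r x (ρ x) := by
  induction l generalizing a with
  | nil => simp only [List.nil_append, List.isChain_cons_cons] at hc hr; simpa [hc.1] using hr.1
  | cons b l ih =>
    rw [List.cons_append, List.isChain_cons_cons] at hc hr
    rw [List.forall_mem_cons]
    exact ⟨by rw [hc.1]; exact hr.1, ih hc.2 hr.2⟩

lemma apply_mem_of_isChain {ρ : Equiv.Perm (Fin m)} {a c : Fin m} {l : List (Fin m)}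
    (hc : (a :: (l ++ [c])).IsChain fun x y => ρ x = y) : ∀ x ∈ a :: l, ρ x ∈ l ++ [c] := by
  induction l generalizing a with
  | nil => simp only [List.nil_append, List.isChain_cons_cons] at hc; simp [hc.1]
  | cons b l ih =>
    rw [List.cons_append, List.isChain_cons_cons] at hc
    rw [List.forall_mem_cons]
    exact ⟨by simp [hc.1], fun x hx => List.mem_cons_of_mem _ (ih hc.2 x hx)⟩

lemma exists_apply_eq_of_isChain {ρ : Equiv.Perm (Fin m)} {a c : Fin m} {l : List (Fin m)}
    (hc : (a :: (l ++ [c])).IsChain fun x y => ρ x = y) : ∃ x ∈ a :: l, ρ x = c := by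
  induction l generalizing a with
  | nil => simp only [List.nil_append, List.isChain_cons_cons] at hc; simp [hc.1]
  | cons b l ih =>
    rw [List.cons_append, List.isChain_cons_cons] at hc
    obtain ⟨x, hx, h⟩ := ih hc.2
    exact ⟨x, List.mem_cons_of_mem _ hx, h⟩

lemma eq_of_isChain {ρ : Equiv.Perm (Fin m)} {a c : Fin m} {t t' : List (Fin m)} (h : c ∉ t)
    (h' : c ∉ t') (hc : (a :: (t ++ [c])).IsChain fun x y => ρ x = y)
    (hc' : (a :: (t' ++ [c])).IsChain fun x y => ρ x = y) : t = t' := by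
  induction t generalizing a t' with
  | nil =>
    rcases t' with _ | ⟨b, t'⟩
    · rfl
    · simp only [List.nil_append, List.cons_append, List.isChain_cons_cons] at hc hc'
      exact absurd (hc.1.symm.trans hc'.1) fun h => h' (by simp [h])
  | cons b t ih =>
    rcases t' with _ | ⟨b', t'⟩
    · simp only [List.nil_append, List.cons_append, List.isChain_cons_cons] at hc hc'
      exact absurd (hc'.1.symm.trans hc.1) fun h' => h (by simp [h'])
    · simp only [List.cons_append, List.isChain_cons_cons, List.mem_cons, not_or] at hc hc' h h'
      obtain rfl : b = b' := hc.1.symm.trans hc'.1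
      rw [ih h.2 h'.2 hc.2 hc'.2]

lemma IsStandard.apply_mem {cs : List (List (Fin m))} (h : IsStandard cs) {c : Fin m}
    {t : List (Fin m)} (hw : c :: t ∈ cs) {x : Fin m} (hx : x ∈ c :: t) :
    ofCycles cs x ∈ c :: t := by
  simpa [or_comm] using apply_mem_of_isChain (h.isChain hw) x hx

/-- Words meeting in a letter contain each other, both being closed under the permutation. So they
share their minimum, and reading the permutation from there gives the same word. -/
lemma IsStandard.subset_of_ofCycles_eq {cs cs' : List (List (Fin m))} (h : IsStandard cs)
    (h' : IsStandard cs') (heq : ofCycles cs = ofCycles cs') : cs ⊆ cs' := by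
  have sub {cs cs' : List (List (Fin m))} (h : IsStandard cs) (h' : IsStandard cs')
      (heq : ofCycles cs = ofCycles cs') {c c' : Fin m} {t t' : List (Fin m)} (hw : c :: t ∈ cs)
      (hw' : c' :: t' ∈ cs') (hc : c ∈ c' :: t') : ∀ x ∈ c :: t, x ∈ c' :: t' := fun x hx =>
    mem_of_isChain (S := {x | x ∈ c' :: t'}) (fun y hy => h'.apply_mem hw' hy) hc
      (heq ▸ h.isChain hw) x (by simp only [List.mem_cons] at hx; simp; tauto)
  intro w hw
  obtain ⟨c, t, rfl, ht⟩ := h.head_lt w hw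
  obtain ⟨c', t', hw', hc⟩ := h'.exists_mem c
  obtain ⟨c₂, t₂, hw₂, hc'⟩ := h.exists_mem c'
  have h2 := h.eq_of_mem hw hw₂ (List.mem_cons_self)
    (sub h' h heq.symm hw' hw₂ hc' c hc)
  rw [← h2] at hc'
  have hcc : c = c' := by
    rcases List.mem_cons.1 hc with h3 | h3
    · exact h3
    · rcases List.mem_cons.1 hc' with h4 | h4
      · exact h4.symm
      · exact absurd (ht _ h4) (h'.lt_of_mem hw' _ h3).asymm
  subst hcc
  rwa [eq_of_isChain (fun h3 => (ht c h3).false) (fun h3 => (h'.lt_of_mem hw' c h3).false)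
    (h.isChain hw) (heq ▸ h'.isChain hw')]

lemma IsStandard.eq_of_ofCycles_eq {cs cs' : List (List (Fin m))} (h : IsStandard cs)
    (h' : IsStandard cs') (heq : ofCycles cs = ofCycles cs') : cs = cs' := by
  have nd {cs : List (List (Fin m))} (h : IsStandard cs) : cs.Nodup := by
    have := h.heads
    rw [List.pairwise_map] at this
    refine this.imp ?_
    rintro w _ ⟨c, hc, c', hc', hlt⟩ rfl
    exact absurd (Option.mem_unique hc hc') hlt.ne'
  have h1 := h.heads
  have h2 := h'.heads
  rw [List.pairwise_map] at h1 h2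
  -- Both lists have the same words, strictly ordered by decreasing minima.
  refine List.Perm.eq_of_pairwise ?_ h1 h2 ((List.perm_ext_iff_of_nodup (nd h) (nd h')).2 fun w =>
    ⟨fun hw => h.subset_of_ofCycles_eq h' heq hw, fun hw => h'.subset_of_ofCycles_eq h heq.symm hw⟩)
  rintro w w' - - ⟨c, hc, c', hc', hlt⟩ ⟨d', hd', d, hd, hlt'⟩
  rw [Option.mem_unique hc hd, Option.mem_unique hc' hd'] at hlt
  exact absurd hlt' hlt.asymm

/-! ### Left-to-right minima and the fundamental bijection -/

lemma lrMinBlocks_cons (a : Fin m) (t : List (Fin m)) :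
    lrMinBlocks (a :: t) =
      (a :: t.takeWhile (fun b => a < b)) :: lrMinBlocks (t.dropWhile (fun b => a < b)) := by
  rw [lrMinBlocks]

lemma lrMinBlocks_nil : lrMinBlocks ([] : List (Fin m)) = [] := by
  rw [lrMinBlocks]

lemma le_of_mem_head?_dropWhile {a y : Fin m} {t : List (Fin m)}
    (h : y ∈ (t.dropWhile (fun b => a < b)).head?) : y ≤ a := by
  have := List.head?_dropWhile_not (fun b => decide (a < b)) t
  rw [Option.mem_def.1 h] at this
  simpa using this

lemma flatten_lrMinBlocks (w : List (Fin m)) : (lrMinBlocks w).flatten = w := by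
  induction w using lrMinBlocks.induct with
  | case1 => rw [lrMinBlocks_nil]; rfl
  | case2 a t ih =>
    rw [lrMinBlocks_cons, List.flatten_cons, ih, List.cons_append, List.takeWhile_append_dropWhile]

lemma head_lt_of_mem_lrMinBlocks (w : List (Fin m)) :
    ∀ b ∈ lrMinBlocks w, ∃ c t, b = c :: t ∧ ∀ x ∈ t, c < x := by
  induction w using lrMinBlocks.induct with
  | case1 => simp [lrMinBlocks_nil]
  | case2 a t ih =>
    rw [lrMinBlocks_cons, List.forall_mem_cons]
    exact ⟨⟨a, _, rfl, fun x hx => by simpa using List.mem_takeWhile_imp hx⟩, ih⟩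

lemma head?_lrMinBlocks_lt (w : List (Fin m)) {a : Fin m} (ha : ∀ x ∈ w.head?, x < a) :
    ∀ b ∈ lrMinBlocks w, ∃ c ∈ b.head?, c < a := by
  induction w using lrMinBlocks.induct with
  | case1 => simp [lrMinBlocks_nil]
  | case2 a' t ih =>
    have h : a' < a := ha a' rfl
    rw [lrMinBlocks_cons, List.forall_mem_cons]
    exact ⟨⟨a', rfl, h⟩, ih fun x hx => (le_of_mem_head?_dropWhile hx).trans_lt h⟩

lemma pairwise_head?_lrMinBlocks (w : List (Fin m)) (hw : w.Nodup) :
    ((lrMinBlocks w).map List.head?).Pairwise fun o o' => ∃ c ∈ o, ∃ c' ∈ o', c' < c := by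
  induction w using lrMinBlocks.induct with
  | case1 => simp [lrMinBlocks_nil]
  | case2 a t ih =>
    rw [List.nodup_cons] at hw
    rw [lrMinBlocks_cons, List.map_cons, List.pairwise_cons, List.forall_mem_map]
    refine ⟨fun b hb => ⟨a, rfl, head?_lrMinBlocks_lt _ (fun x hx => ?_) b hb⟩,
      ih (hw.2.sublist (List.dropWhile_sublist _))⟩
    refine lt_of_le_of_ne (le_of_mem_head?_dropWhile hx) ?_
    rintro rfl
    exact hw.1 ((List.dropWhile_sublist _).subset (List.mem_of_mem_head? hx))

lemma isStandard_lrMinBlocks (π : Equiv.Perm (Fin m)) :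
    IsStandard (lrMinBlocks (List.ofFn π)) where
  head_lt := head_lt_of_mem_lrMinBlocks _
  heads := pairwise_head?_lrMinBlocks _ (List.nodup_ofFn.2 π.injective)
  nodup := by rw [flatten_lrMinBlocks]; exact List.nodup_ofFn.2 π.injective
  mem x := by rw [flatten_lrMinBlocks, List.mem_ofFn]; exact π.surjective x

lemma isStandard_cycleWords (π : Equiv.Perm (Fin m)) : IsStandard (cycleWords π) := by
  refine (isStandard_lrMinBlocks π).of_forall₂ ?_
  rw [cycleWords, List.forall₂_map_right_iff, List.forall₂_same]
  intro w hw
  obtain ⟨c, t, rfl, -⟩ := head_lt_of_mem_lrMinBlocks _ w hw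
  exact ⟨c, t, _, rfl, rfl, (List.reverse_perm t).symm⟩

lemma reverseTail_reverseTail (w : List (Fin m)) : reverseTail (reverseTail w) = w := by
  cases w <;> simp [reverseTail]

lemma cycleWords_injective : Function.Injective (cycleWords (m := m)) := by
  intro π π' h
  have h1 := (Function.LeftInverse.injective reverseTail_reverseTail).list_map h
  have h2 := congrArg List.flatten h1
  rw [flatten_lrMinBlocks, flatten_lrMinBlocks] at h2
  exact Equiv.ext fun x => congrFun (List.ofFn_injective h2) x

/-- Uniqueness of standard notation gives injectivity; finiteness gives the rest, so no inverse is
constructed. -/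
lemma bijective_ofCycles_cycleWords :
    Function.Bijective fun π : Equiv.Perm (Fin m) => ofCycles (cycleWords π) :=
  Finite.injective_iff_bijective.1 fun π π' h => cycleWords_injective
    ((isStandard_cycleWords π).eq_of_ofCycles_eq (isStandard_cycleWords π') h)

lemma IsStandard.exists_cycleWords_eq {cs : List (List (Fin m))} (h : IsStandard cs) :
    ∃ π, cycleWords π = cs := by
  obtain ⟨π, hπ⟩ := bijective_ofCycles_cycleWords.2 (ofCycles cs)
  exact ⟨π, (isStandard_cycleWords π).eq_of_ofCycles_eq h hπ⟩

/-- The word descends at each cut, where `r` holds for free. -/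
lemma isChain_iff_forall_lrMinBlocks {r : Fin m → Fin m → Prop} (hr : ∀ a b, b ≤ a → r a b)
    (w : List (Fin m)) : w.IsChain r ↔ ∀ b ∈ lrMinBlocks w, b.IsChain r := by
  induction w using lrMinBlocks.induct with
  | case1 => simp [lrMinBlocks_nil]
  | case2 a t ih =>
    rw [lrMinBlocks_cons, List.forall_mem_cons, ← ih]
    conv_lhs => rw [← List.takeWhile_append_dropWhile (p := fun b => decide (a < b)) (l := t),
      ← List.cons_append, List.isChain_append]
    refine and_congr_right fun _ => and_iff_left_of_imp fun _ x hx y hy => hr _ _ ?_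
    refine (le_of_mem_head?_dropWhile hy).trans ?_
    rcases List.mem_cons.1 (List.mem_of_mem_getLast? hx) with rfl | hx
    · rfl
    · exact le_of_lt (by simpa using List.mem_takeWhile_imp hx)

/-! ### The bijection `ϑ` -/

lemma mem_oddEvenAscents_iff_isChain {n : ℕ} (π : Equiv.Perm (Fin (2 * n))) :
    π ∈ oddEvenAscents n ↔ (List.ofFn π).IsChain fun a b => EvenOddDescent b a := by
  rw [List.isChain_ofFn]
  simp only [oddEvenAscents, Set.mem_ofPred_eq, EvenOddDescent, EvenLetter, Nat.not_even_iff_odd]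
  constructor
  · intro h i hi hlt
    have := h (i + 1) (by omega) hi
    rw [entry_of_mem π hi, entry_of_mem π (by omega : i < 2 * n)] at this
    exact (this (by rw [Fin.lt_def] at hlt; omega)).symm
  · intro h i h1 h2
    obtain ⟨j, rfl⟩ : ∃ j, i = j + 1 := ⟨i - 1, by omega⟩
    rw [entry_of_mem π (by omega : j + 1 < 2 * n), entry_of_mem π (by omega : j < 2 * n)]
    intro hlt
    exact (h j h2 (by rw [Fin.lt_def]; omega)).symm

/-- Reversal turns ascents into descents. The only new step of the closed word, from `c` to its
successor, is never a descent. -/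
lemma mem_oddEvenAscents_iff {n : ℕ} (π : Equiv.Perm (Fin (2 * n))) :
    π ∈ oddEvenAscents n ↔
      ∀ c t, c :: t ∈ cycleWords π → (c :: (t ++ [c])).IsChain EvenOddDescent := by
  have desc (a b : Fin (2 * n)) (h : b ≤ a) : EvenOddDescent b a := fun h' => absurd h h'.not_ge
  have key {c : Fin (2 * n)} {t : List (Fin (2 * n))} (h : ∀ x ∈ t, c < x) :
      (c :: (t.reverse ++ [c])).IsChain EvenOddDescent ↔
        (c :: t).IsChain fun a b => EvenOddDescent b a := by
    rw [show c :: (t.reverse ++ [c]) = ((c :: t) ++ [c]).reverse by simp, List.isChain_reverse,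
      List.isChain_append]
    refine and_iff_left ⟨List.isChain_singleton _, fun x hx y hy => desc _ _ ?_⟩
    rw [List.head?_cons, Option.mem_some] at hy
    subst hy
    rcases List.mem_cons.1 (List.mem_of_mem_getLast? hx) with rfl | hx
    · rfl
    · exact (h x hx).le
  rw [mem_oddEvenAscents_iff_isChain, isChain_iff_forall_lrMinBlocks desc]
  constructor
  · intro h c t hw
    obtain ⟨b, hb, hbw⟩ := List.mem_map.1 hw
    obtain ⟨c', t', rfl, ht⟩ := head_lt_of_mem_lrMinBlocks _ b hb
    obtain ⟨rfl, rfl⟩ := List.cons_eq_cons.1 hbw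
    exact (key ht).2 (h _ hb)
  · intro h b hb
    obtain ⟨c, t, rfl, ht⟩ := head_lt_of_mem_lrMinBlocks _ b hb
    exact (key ht).1 (h _ _ (List.mem_map.2 ⟨_, hb, rfl⟩))

lemma IsStandard.mem_dPerms_iff {n : ℕ} {cs : List (List (Fin (2 * n)))} (h : IsStandard cs) :
    ofCycles cs ∈ dPerms n ↔ ∀ c t, c :: t ∈ cs → (c :: (t ++ [c])).IsChain ParityStep := by
  rw [Genocchi.mem_dPerms_iff]
  constructor
  · intro hD c t hw
    exact (h.isChain hw).imp fun {x y} hxy => (hxy : ofCycles cs x = y) ▸ hD x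
  · intro hc x
    obtain ⟨c, t, hw, hx⟩ := h.exists_mem x
    exact rel_apply_of_isChain (h.isChain hw) (hc c t hw) x hx

/-- The words `w` and `w'` have the same first letter, and the remaining word of `w'` is the
shifted remaining word of `w`. -/
def ShiftedWord (w w' : List (Fin m)) : Prop :=
  ∃ c u v, w = c :: u ∧ w' = c :: v ∧ Shifts u v

lemma leftUnique_shiftedWord : Relator.LeftUnique (ShiftedWord (m := m)) := by
  rintro _ _ _ ⟨c, u, v, rfl, rfl, h⟩ ⟨c', u', v', rfl, hw, h'⟩
  obtain ⟨rfl, rfl⟩ := List.cons_eq_cons.1 hw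
  rw [h.left_unique h']

lemma IsStandard.of_forall₂_shiftedWord {cs cs' : List (List (Fin m))} (h : IsStandard cs)
    (h' : List.Forall₂ ShiftedWord cs cs') : IsStandard cs' := by
  refine h.of_forall₂ (h'.imp ?_)
  rintro _ _ ⟨c, u, v, rfl, rfl, hs⟩
  exact ⟨c, u, v, rfl, rfl, hs.perm⟩

lemma IsStandard.of_forall₂_shiftedWord' {cs cs' : List (List (Fin m))} (h : IsStandard cs')
    (h' : List.Forall₂ ShiftedWord cs cs') : IsStandard cs := by
  refine h.of_forall₂ (h'.flip.imp ?_)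
  rintro _ _ ⟨c, u, v, rfl, rfl, hs⟩
  exact ⟨c, v, u, rfl, rfl, hs.perm.symm⟩

lemma IsStandard.shiftCycle_eq {cs : List (List (Fin m))} (h : IsStandard cs) {w w' : List (Fin m)}
    (hw : w ∈ cs) (hs : ShiftedWord w w') : shiftCycle (ofCycles cs) w = w' := by
  obtain ⟨c, u, v, rfl, rfl, hs⟩ := hs
  have hc := h.isChain hw
  have hlt := h.lt_of_mem hw
  rw [shiftCycle_cons, if_neg, hs.shiftCycle_eq hlt hlt hc]
  -- The minimum `c` has no smaller predecessor in its cycle, so it is never shifted.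
  rintro ⟨-, h1, -⟩
  obtain ⟨x, hx, hxc⟩ := exists_apply_eq_of_isChain hc
  rw [← hxc, Equiv.Perm.inv_def, Equiv.symm_apply_apply, hxc] at h1
  rcases List.mem_cons.1 hx with rfl | hx
  · exact h1.false
  · exact h1.asymm (hlt x hx)

lemma IsStandard.exists_shifts {cs : List (List (Fin m))} (h : IsStandard cs) {c : Fin m}
    {u : List (Fin m)} (hw : c :: u ∈ cs) (hc : (c :: (u ++ [c])).IsChain EvenOddDescent) :
    ∃ v, Shifts u v :=
  exists_shifts_of_isChain u (List.nodup_cons.1 ((List.nodup_flatten.1 h.nodup).1 _ hw)).2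
    (h.lt_of_mem hw) (h.lt_of_mem hw) hc

lemma IsStandard.forall₂_shiftedWord {cs : List (List (Fin m))} (h : IsStandard cs)
    (hE : ∀ c t, c :: t ∈ cs → (c :: (t ++ [c])).IsChain EvenOddDescent) :
    List.Forall₂ ShiftedWord cs (cs.map (shiftCycle (ofCycles cs))) := by
  rw [List.forall₂_map_right_iff, List.forall₂_same]
  intro w hw
  obtain ⟨c, u, rfl, -⟩ := h.head_lt w hw
  obtain ⟨v, hv⟩ := h.exists_shifts hw (hE c u hw)
  have hs : ShiftedWord (c :: u) (c :: v) := ⟨c, u, v, rfl, rfl, hv⟩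
  rwa [h.shiftCycle_eq hw hs]

lemma IsStandard.map_shiftCycle_eq {cs cs' : List (List (Fin m))} (h : IsStandard cs)
    (h' : List.Forall₂ ShiftedWord cs cs') : cs.map (shiftCycle (ofCycles cs)) = cs' := by
  rw [← List.forall₂_eq_eq_eq, List.forall₂_map_left_iff]
  rw [List.forall₂_iff_get] at h' ⊢
  exact ⟨h'.1, fun i h1 h2 => h.shiftCycle_eq (List.get_mem _ _) (h'.2 i h1 h2)⟩

/-- The step closing the cycle is a descent to `c`. -/
lemma not_evenLetter_of_isChain {a c : Fin m} {u : List (Fin m)} (hu : u ≠ [])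
    (hlt : ∀ x ∈ u, c < x) (hc : (a :: (u ++ [c])).IsChain EvenOddDescent) : ¬ EvenLetter c := by
  obtain ⟨K, y, rfl⟩ := (List.eq_nil_or_concat' u).resolve_left hu
  rw [List.append_assoc, ← List.cons_append, List.isChain_append] at hc
  exact ((List.isChain_cons_cons.1 hc.2.1).1 (hlt y (by simp))).2

lemma vartheta_mem_dPerms {n : ℕ} {π : Equiv.Perm (Fin (2 * n))} (hπ : π ∈ oddEvenAscents n) :
    vartheta π ∈ dPerms n := by
  have h := isStandard_cycleWords π
  rw [mem_oddEvenAscents_iff] at hπ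
  have hS := h.forall₂_shiftedWord hπ
  rw [vartheta, (h.of_forall₂_shiftedWord hS).mem_dPerms_iff]
  intro c v hw
  obtain ⟨w, hw0, hwv⟩ := List.mem_map.1 hw
  rw [List.forall₂_map_right_iff, List.forall₂_same] at hS
  obtain ⟨c', u, v', rfl, hwv', hs⟩ := hS w hw0
  obtain ⟨rfl, rfl⟩ := List.cons_eq_cons.1 (hwv.symm.trans hwv')
  by_cases hu : u = []
  · rw [hs.eq_nil_iff.1 hu]
    simp [ParityStep]
  · have hlt := h.lt_of_mem hw0
    exact hs.isChain_right hu hlt hlt (not_evenLetter_of_isChain hu hlt (hπ _ _ hw0))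

lemma vartheta_injOn (n : ℕ) : Set.InjOn vartheta (oddEvenAscents n) := by
  intro π hπ π' hπ' heq
  rw [mem_oddEvenAscents_iff] at hπ hπ'
  have h := isStandard_cycleWords π
  have h' := isStandard_cycleWords π'
  have hS := h.forall₂_shiftedWord hπ
  have hS' := h'.forall₂_shiftedWord hπ'
  have := (h.of_forall₂_shiftedWord hS).eq_of_ofCycles_eq (h'.of_forall₂_shiftedWord hS') heq
  rw [← this] at hS'
  exact cycleWords_injective (leftUnique_shiftedWord.forall₂ hS hS')

lemma exists_vartheta_eq {n : ℕ} {σ : Equiv.Perm (Fin (2 * n))} (hσ : σ ∈ dPerms n) :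
    ∃ π ∈ oddEvenAscents n, vartheta π = σ := by
  obtain ⟨π₀, rfl⟩ := bijective_ofCycles_cycleWords.2 σ
  have h₀ := isStandard_cycleWords π₀
  simp only at hσ ⊢
  rw [h₀.mem_dPerms_iff] at hσ
  have hex (w : List (Fin (2 * n))) (hw : w ∈ cycleWords π₀) : ∃ w', ShiftedWord w' w := by
    obtain ⟨c, v, rfl, hlt⟩ := h₀.head_lt w hw
    obtain ⟨u, hu⟩ := exists_shifts_of_isChain' v
      (List.nodup_cons.1 ((List.nodup_flatten.1 h₀.nodup).1 _ hw)).2 hlt hlt (hσ c v hw)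
    exact ⟨c :: u, c, u, v, rfl, rfl, hu⟩
  choose! f hf using hex
  have hS : List.Forall₂ ShiftedWord ((cycleWords π₀).map f) (cycleWords π₀) := by
    rw [List.forall₂_map_left_iff, List.forall₂_same]
    exact hf
  have h := h₀.of_forall₂_shiftedWord' hS
  obtain ⟨π, hπ⟩ := h.exists_cycleWords_eq
  refine ⟨π, ?_, ?_⟩
  · rw [mem_oddEvenAscents_iff, hπ]
    intro c u hw
    obtain ⟨w, hw0, hwu⟩ := List.mem_map.1 hw
    obtain ⟨c', u', v, hwu', rfl, hs⟩ := hf w hw0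
    obtain ⟨rfl, rfl⟩ := List.cons_eq_cons.1 (hwu.symm.trans hwu')
    by_cases hu : u = []
    · subst hu
      simp [EvenOddDescent]
    · have hlt := h₀.lt_of_mem hw0
      -- The minimum `c` is odd, since the first step of its nontrivial cycle in `σ` goes up.
      refine hs.isChain_left hu (h.lt_of_mem hw) fun hc => ?_
      obtain ⟨y, v, rfl⟩ := List.exists_cons_of_ne_nil (mt hs.eq_nil_iff.2 hu)
      have := hσ _ _ hw0
      rw [List.cons_append, List.isChain_cons_cons] at this
      exact absurd (hlt y (by simp)) (this.1.2 hc).not_gt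
  · rw [vartheta, hπ, h.map_shiftCycle_eq hS]

lemma exists_vartheta (n : ℕ) : ∃ ϑ : oddEvenAscents n ≃ dPerms n,
    ∀ π : oddEvenAscents n, (ϑ π : Equiv.Perm (Fin (2 * n))) = vartheta π := by
  have hb : Set.BijOn vartheta (oddEvenAscents n) (dPerms n) :=
    ⟨fun _ h => vartheta_mem_dPerms h, vartheta_injOn n, fun _ h => exists_vartheta_eq h⟩
  exact ⟨hb.equiv _, fun _ => rfl⟩

end Genocchi

theorem theorem4p2 (n : ℕ) :
    (Genocchi.collapsed (n + 1)).ncard = Genocchi.medianGenocchi n ∧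
    Genocchi.medianGenocchi n = (Genocchi.oddEvenAscents n).ncard ∧
    ∃ (θ : Genocchi.collapsed (n + 1) ≃ Genocchi.dPerms n)
      (ϑ : Genocchi.oddEvenAscents n ≃ Genocchi.dPerms n),
      Genocchi.IsTheta θ ∧
      (∀ π : Genocchi.oddEvenAscents n,
        (ϑ π : Equiv.Perm (Fin (2 * n))) = Genocchi.vartheta (π : Equiv.Perm (Fin (2 * n)))) ∧
      Function.Bijective
        (ϑ.symm ∘ θ : Genocchi.collapsed (n + 1) → Genocchi.oddEvenAscents n) := by
  obtain ⟨θ, hθ⟩ := Genocchi.exists_theta n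
  obtain ⟨ϑ, hϑ⟩ := Genocchi.exists_vartheta n
  refine ⟨?_, ?_, θ, ϑ, hθ, hϑ, (θ.trans ϑ.symm).bijective⟩
  · rw [← Genocchi.ncard_dPerms]
    exact Nat.card_congr θ
  · rw [← Genocchi.ncard_dPerms]
    exact (Nat.card_congr ϑ).symm
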